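/- Let $X$ be a topological space and $\kappa$ an infinite cardinal. A family of sets is \emph{centered} if each of its non-empty finite subfamilies has non-empty intersection, and \emph{linked} if any two of its members intersect. The cardinal $\kappa$ is a \emph{caliber} (resp. \emph{precaliber}, \emph{weak precaliber}) of $X$ if for every indexed family $\{U_\alpha:\alpha<\kappa\}$ of non-empty open subsets of $X$, repetitions allowed, there is $J\subseteq\kappa$ with $|J|=\kappa$ such that $\{U_\alpha:\alpha\in J\}$ has non-empty intersection (resp. is centered, is linked). It is a \emph{caliber*} (resp. \emph{precaliber*}, \emph{weak precaliber*}) of $X$ if every set $\mathcal U$ of non-empty open subsets of $X$ with $|\mathcal U|=\kappa$ has a subset $\mathcal V\subseteq\mathcal U$ with $|\mathcal V|=\kappa$ that has non-empty intersection (resp. is centered, is linked). Let $\mathsf{CN}$ be the class of infinite cardinals. Let $\mathsf C(X),\mathsf P(X),\mathsf{WP}(X)$ be the classes of all $\kappa\in\mathsf{CN}$ that are calibers, precalibers, weak precalibers of $X$ respectively, and let $\mathsf C^*(X),\mathsf P^*(X),\mathsf{WP}^*(X)$ be the corresponding classes for the starred notions. Let $D(2)^\lambda$ be the product of $\lambda$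 copies of the two-point discrete space, with the product topology. \textbf{Corollary.} Let $\lambda$ be a cardinal. (1) If $\lambda$ is infinite, then $$\mathsf C(D(2)^\lambda)=\mathsf P(D(2)^\lambda)=\mathsf{WP}(D(2)^\lambda)=\{\kappa\in\mathsf{CN}:\operatorname{cf}(\kappa)>\omega\}.$$ (2) For every $\lambda$, finite or infinite, $$\mathsf C^*(D(2)^\lambda)=\mathsf P^*(D(2)^\lambda)=\mathsf{WP}^*(D(2)^\lambda)=\{\kappa\in\mathsf{CN}:\kappa>2^\lambda\}\cup\{\kappa\in\mathsf{CN}:\kappa\le 2^\lambda\wedge\operatorname{cf}(\kappa)>\omega\}.$$ -/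

import Mathlib

open Cardinal

universe u

/-- A family of sets is centered if every non-empty finite subfamily has non-empty intersection. -/
def IsCentered {X : Type u} (V : Set (Set X)) : Prop :=
  ∀ F : Set (Set X), F ⊆ V → F.Finite → F.Nonempty → (⋂₀ F).Nonempty

/-- A family of sets is linked if any two of its members meet. -/
def IsLinked {X : Type u} (V : Set (Set X)) : Prop :=
  ∀ A ∈ V, ∀ B ∈ V, (A ∩ B).Nonempty

section Indexed

variable (X : Type u) [TopologicalSpace X] (κ : Cardinal.{u})

/-- `κ` is a caliber of `X`: every family of non-empty open sets, indexed (possibly with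
repetitions) by a set `I` of cardinality `κ`, has `κ` many indices whose members have a
common point. -/
def IsCaliber : Prop :=
  ∀ (I : Type u), #I = κ → ∀ U : I → Set X, (∀ i, IsOpen (U i) ∧ (U i).Nonempty) →
    ∃ J : Set I, #J = κ ∧ (⋂ i ∈ J, U i).Nonempty

/-- `κ` is a precaliber of `X`. -/
def IsPrecaliber : Prop :=
  ∀ (I : Type u), #I = κ → ∀ U : I → Set X, (∀ i, IsOpen (U i) ∧ (U i).Nonempty) →
    ∃ J : Set I, #J = κ ∧ IsCentered (U '' J)

/-- `κ` is a weak precaliber of `X`. -/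
def IsWeakPrecaliber : Prop :=
  ∀ (I : Type u), #I = κ → ∀ U : I → Set X, (∀ i, IsOpen (U i) ∧ (U i).Nonempty) →
    ∃ J : Set I, #J = κ ∧ IsLinked (U '' J)

/-- `κ` is a caliber* of `X`: every set of `κ` many non-empty open sets has a subset of
cardinality `κ` with non-empty intersection. -/
def IsCaliberStar : Prop :=
  ∀ 𝒰 : Set (Set X), #𝒰 = κ → (∀ A ∈ 𝒰, IsOpen A ∧ A.Nonempty) →
    ∃ 𝒱 : Set (Set X), 𝒱 ⊆ 𝒰 ∧ #𝒱 = κ ∧ (⋂₀ 𝒱).Nonempty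

/-- `κ` is a precaliber* of `X`. -/
def IsPrecaliberStar : Prop :=
  ∀ 𝒰 : Set (Set X), #𝒰 = κ → (∀ A ∈ 𝒰, IsOpen A ∧ A.Nonempty) →
    ∃ 𝒱 : Set (Set X), 𝒱 ⊆ 𝒰 ∧ #𝒱 = κ ∧ IsCentered 𝒱

/-- `κ` is a weak precaliber* of `X`. -/
def IsWeakPrecaliberStar : Prop :=
  ∀ 𝒰 : Set (Set X), #𝒰 = κ → (∀ A ∈ 𝒰, IsOpen A ∧ A.Nonempty) →
    ∃ 𝒱 : Set (Set X), 𝒱 ⊆ 𝒰 ∧ #𝒱 = κ ∧ IsLinked 𝒱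

end Indexed

/-- The class of infinite cardinals. -/
def CN : Set Cardinal.{u} := {κ | ℵ₀ ≤ κ}

section Classes

variable (X : Type u) [TopologicalSpace X]

/-- The infinite calibers of `X`. -/
def calibers : Set Cardinal.{u} := {κ | κ ∈ CN ∧ IsCaliber X κ}

/-- The infinite precalibers of `X`. -/
def precalibers : Set Cardinal.{u} := {κ | κ ∈ CN ∧ IsPrecaliber X κ}

/-- The infinite weak precalibers of `X`. -/
def weakPrecalibers : Set Cardinal.{u} := {κ | κ ∈ CN ∧ IsWeakPrecaliber X κ}

/-- The infinite calibers* of `X`. -/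
def calibersStar : Set Cardinal.{u} := {κ | κ ∈ CN ∧ IsCaliberStar X κ}

/-- The infinite precalibers* of `X`. -/
def precalibersStar : Set Cardinal.{u} := {κ | κ ∈ CN ∧ IsPrecaliberStar X κ}

/-- The infinite weak precalibers* of `X`. -/
def weakPrecalibersStar : Set Cardinal.{u} := {κ | κ ∈ CN ∧ IsWeakPrecaliberStar X κ}

end Classes

/-- The Cantor cube `D(2)^lam`: the product of `lam` many copies of the two-point discrete space,
with the product topology. -/
abbrev CantorCube (lam : Cardinal.{u}) : Type u := lam.out → Bool

/-! A non-empty open set contains a cylinder given by a finite partial function, so for uncountable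
cofinality it suffices to find a point extending `κ` of any `κ` such functions. Sizes may be taken
bounded, and `exists_extends_of_card_le` then replaces the Δ-system lemma, needing only agreement on
fewer than `κ` coordinates. For regular `κ` that is a pigeonhole; for singular `κ`,
`exists_agree_of_cof` applies the regular case to `cf κ` representatives of large fibres. For
countable cofinality, `κ` splits into countably many smaller pieces, assigned to disjoint cylinders;
deleting distinct points makes the sets distinct when `κ ≤ 2 ^ #A`. Above `2 ^ lam` there are too
few open sets, so the starred properties hold vacuously. -/

theorem Cardinal.mk_finset_lt {B : Type u} {κ : Cardinal.{u}} (hκ : ℵ₀ < κ) (hB : #B < κ) :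
    #(Finset B) < κ := by
  rcases finite_or_infinite B with h | h
  · exact (mk_lt_aleph0 (α := Finset B)).trans hκ
  · rwa [mk_finset_of_infinite]

/-! ### Common extensions of finite partial functions -/

/-- If fewer than `κ` coordinates can be handled simultaneously for `κ` many finite partial
functions, then `κ` many of any `κ` finite partial functions with supports of bounded size have a
common extension. -/
theorem exists_extends_of_card_le {A : Type u} {κ : Cardinal.{u}} (hκ : ℵ₀ < κ)
    (hT : ∀ I : Type u, #I = κ → ∀ T : Set A, #T < κ → ∀ (y : I → A → Bool) (F : I → Finset A),
      ∃ x : A → Bool, #{i | ∀ a ∈ F i, a ∈ T → x a = y i a} = κ) (n : ℕ) :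
    ∀ I : Type u, #I = κ → ∀ (y : I → A → Bool) (F : I → Finset A), (∀ i, (F i).card ≤ n) →
      ∃ x : A → Bool, #{i | ∀ a ∈ F i, x a = y i a} = κ := by
  classical
  induction n with
  | zero =>
    intro I hI y F hF
    refine ⟨fun _ => false, ?_⟩
    have h : {i | ∀ a ∈ F i, false = y i a} = Set.univ := by
      ext i
      simp [Finset.card_eq_zero.1 (Nat.le_zero.1 (hF i))]
    rw [h, mk_univ, hI]
  | succ n ih =>
    intro I hI y F hF
    obtain ⟨J, hJ⟩ := zorn_subset {J : Set I | J.PairwiseDisjoint F} (fun c hc hchain =>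
      ⟨⋃₀ c, (Set.pairwiseDisjoint_sUnion hchain.directedOn).2 hc,
        fun s hs => Set.subset_sUnion_of_mem hs⟩)
    rcases (hI ▸ mk_set_le J : #J ≤ κ).eq_or_lt with hJκ | hJκ
    · refine ⟨fun a => if h : ∃ i ∈ J, a ∈ F i then y h.choose a else false,
        ((mk_set_le _).trans_eq hI).antisymm (hJκ ▸ mk_le_mk_of_subset fun i hi a ha => ?_)⟩
      have h : ∃ i ∈ J, a ∈ F i := ⟨i, hi, ha⟩
      have hd := hJ.prop.elim_finset h.choose_spec.1 hi a h.choose_spec.2 ha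
      simp only [dif_pos h]
      rw [hd]
    · have hTκ : #(⋃ i ∈ J, (F i : Set A)) < κ := by
        refine (mk_biUnion_le _ J).trans_lt (mul_lt_of_lt hκ.le hJκ (lt_of_le_of_lt ?_ hκ))
        exact ciSup_le' fun i => (mk_lt_aleph0 (α := (F i.1 : Set A))).le
      set T : Set A := ⋃ i ∈ J, (F i : Set A)
      obtain ⟨x, hx⟩ := hT I hI T hTκ y F
      -- By maximality of `J`, each `F i` meets `T` or is empty, so discarding `T` lowers the size
      -- bound by one.
      obtain ⟨z, hz⟩ := ih _ hx (fun i => y i) (fun i => (F i).filter (· ∉ T)) (by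
        rintro ⟨i, -⟩
        by_cases h : ∃ a ∈ F i, a ∈ T
        · obtain ⟨a, ha, haT⟩ := h
          have : (F i).filter (· ∉ T) ⊂ F i :=
            (Finset.filter_ssubset).2 ⟨a, ha, not_not.2 haT⟩
          have := Finset.card_lt_card this
          have := hF i
          simp only
          omega
        · push Not at h
          have hi : i ∈ J := by
            refine hJ.le_of_ge (y := insert i J) ?_ (Set.subset_insert _ _)
              (Set.mem_insert _ _)
            refine hJ.prop.insert fun j hj _ => Finset.disjoint_left.2 fun a ha haj => ?_
            exact h a ha (Set.mem_biUnion hj haj)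
          have : (F i).filter (· ∉ T) = ∅ :=
            Finset.filter_eq_empty_iff.2 fun a ha => not_not.2 (Set.mem_biUnion hi ha)
          simp [this])
      refine ⟨fun a => if a ∈ T then x a else z a, ((mk_set_le _).trans_eq hI).antisymm ?_⟩
      rw [← hz, ← mk_image_eq (Subtype.val_injective)]
      refine mk_le_mk_of_subset ?_
      rintro _ ⟨⟨i, hi⟩, hi', rfl⟩ a ha
      by_cases haT : a ∈ T
      · simpa [haT] using hi a ha haT
      · simpa [haT] using hi' a (Finset.mem_filter.2 ⟨ha, haT⟩)

/-- Uncountable cofinality lets a pigeonhole on the sizes in `ℕ` fix a single bound. -/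
theorem exists_extends_of_handles {A : Type u} {κ : Cardinal.{u}} (hκ : ℵ₀ < κ.ord.cof)
    (hT : ∀ I : Type u, #I = κ → ∀ T : Set A, #T < κ → ∀ (y : I → A → Bool) (F : I → Finset A),
      ∃ x : A → Bool, #{i | ∀ a ∈ F i, a ∈ T → x a = y i a} = κ)
    (I : Type u) (hI : #I = κ) (y : I → A → Bool) (F : I → Finset A) :
    ∃ x : A → Bool, #{i | ∀ a ∈ F i, x a = y i a} = κ := by
  have hκ' : ℵ₀ < κ := hκ.trans_le (Ordinal.cof_ord_le κ)
  obtain ⟨⟨n⟩, hn⟩ := infinite_pigeonhole (fun i => ULift.up.{u} (F i).card) (hI ▸ hκ'.le)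
    (by rw [hI]; simpa using hκ)
  obtain ⟨x, hx⟩ := exists_extends_of_card_le hκ' hT n _ (hn.trans hI) (fun i => y i)
    (fun i => F i) (fun i => (congrArg ULift.down i.2 : (F i).card = n).le)
  refine ⟨x, ((mk_set_le _).trans_eq hI).antisymm ?_⟩
  rw [← hx, ← mk_image_eq (Subtype.val_injective)]
  refine mk_le_mk_of_subset ?_
  rintro _ ⟨i, hi, rfl⟩
  exact hi

/-! ### Agreement on a small set of coordinates -/

/-- The restriction of `y` to `F ∩ T`, as a finite set of pairs. -/
noncomputable def restrictCode {A : Type u} (T : Set A) (y : A → Bool) (F : Finset A) :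
    Finset (T × Bool) :=
  open Classical in (F.subtype (· ∈ T)).image fun a => (a, y a)

theorem agree_of_restrictCode_eq {A : Type u} {T : Set A} {y z x : A → Bool} {F G : Finset A}
    (h : restrictCode T y F = restrictCode T z G) (hx : ∀ a ∈ F, a ∈ T → x a = y a) :
    ∀ a ∈ G, a ∈ T → x a = z a := by
  intro a ha haT
  have hmem : ((⟨a, haT⟩ : T), z a) ∈ restrictCode T y F := by
    rw [h]
    simp only [restrictCode, Finset.mem_image, Finset.mem_subtype]
    exact ⟨⟨a, haT⟩, ha, rfl⟩
  simp only [restrictCode, Finset.mem_image, Finset.mem_subtype, Prod.mk.injEq] at hmem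
  obtain ⟨_, hb, rfl, hbz⟩ := hmem
  rw [← hbz]
  exact hx a hb haT

theorem mk_finset_prod_bool_lt {A : Type u} {κ : Cardinal.{u}} (hκ : ℵ₀ < κ) {T : Set A}
    (hT : #T < κ) : #(Finset (T × Bool)) < κ := by
  refine mk_finset_lt hκ ?_
  rw [mk_prod]
  exact mul_lt_of_lt hκ.le (by simpa using hT) (by
    simpa using (natCast_lt_aleph0 (n := 2)).trans hκ)

/-- A regular uncountable cardinal handles small sets of coordinates. -/
theorem exists_agree_of_regular {A : Type u} {κ : Cardinal.{u}} (hκ : ℵ₀ < κ)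
    (hreg : κ.ord.cof = κ) (I : Type u) (hI : #I = κ) (T : Set A) (hT : #T < κ)
    (y : I → A → Bool) (F : I → Finset A) :
    ∃ x : A → Bool, #{i | ∀ a ∈ F i, a ∈ T → x a = y i a} = κ := by
  obtain ⟨s, hs⟩ := infinite_pigeonhole (fun i => restrictCode T (y i) (F i)) (hI ▸ hκ.le)
    (by rw [hI, hreg]; exact mk_finset_prod_bool_lt hκ hT)
  have hne : Nonempty ((fun i => restrictCode T (y i) (F i)) ⁻¹' {s}) := by
    rw [← mk_ne_zero_iff, hs, hI]
    exact (aleph0_pos.trans hκ).ne'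
  obtain ⟨⟨j, hj⟩⟩ := hne
  refine ⟨y j, ((mk_set_le _).trans_eq hI).antisymm ?_⟩
  rw [← hI, ← hs]
  refine mk_le_mk_of_subset fun i hi => ?_
  exact agree_of_restrictCode_eq (Eq.trans hj (Eq.symm hi)) fun _ _ _ => rfl

/-- A map from a set of cardinality `κ` to a smaller set has fibres of size above any `θ < κ`. -/
theorem exists_lt_mk_fiber {I K : Type u} {κ θ : Cardinal.{u}} (hκ : ℵ₀ ≤ κ) (hI : #I = κ)
    (hK : #K < κ) (hθ : θ < κ) (f : I → K) : ∃ j, θ < #{i | f i = f j} := by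
  by_contra! h
  refine (lt_irrefl κ) ?_
  calc κ = #(⋃ k, f ⁻¹' {k}) := by
        rw [← Set.preimage_iUnion, Set.iUnion_of_singleton, Set.preimage_univ, mk_univ, hI]
    _ ≤ #K * ⨆ k, #(f ⁻¹' {k}) := mk_iUnion_le_sum_mk.trans (sum_le_mk_mul_iSup _)
    _ < κ := by
      refine mul_lt_of_lt hκ hK (lt_of_le_of_lt (ciSup_le' fun k => ?_) hθ)
      by_cases hk : ∃ j, f j = k
      · obtain ⟨j, rfl⟩ := hk
        exact h j
      · have : f ⁻¹' {k} = ∅ := by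
          ext i
          simpa using fun hi => hk ⟨i, hi⟩
        simp [this]

/-- A cardinal whose cofinality is uncountable handles small sets of coordinates. -/
theorem exists_agree_of_cof {A : Type u} {κ : Cardinal.{u}} (hκ : ℵ₀ < κ.ord.cof)
    (I : Type u) (hI : #I = κ) (T : Set A) (hT : #T < κ)
    (y : I → A → Bool) (F : I → Finset A) :
    ∃ x : A → Bool, #{i | ∀ a ∈ F i, a ∈ T → x a = y i a} = κ := by
  have hκ' : ℵ₀ < κ := hκ.trans_le (Ordinal.cof_ord_le κ)
  have hcc : κ.ord.cof.ord.cof = κ.ord.cof := Ordinal.cof_ord_cof _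
  obtain ⟨C, hC, hCtype⟩ := Ordinal.exists_ord_cof_eq κ.ord.ToType
  rw [Ordinal.cof_toType] at hCtype
  have hCcard : #C = κ.ord.cof := by
    rw [← Ordinal.card_type (· < · : C → C → Prop), hCtype, card_ord]
  have hIic (o : κ.ord.ToType) : #(Set.Iic o) < κ := by
    have := mk_Iic_lt o (by simp) (by simpa using hκ'.le)
    simpa using this
  choose j hj using fun c : C => exists_lt_mk_fiber hκ'.le hI (mk_finset_prod_bool_lt hκ' hT)
    (hIic c.1) (fun i => restrictCode T (y i) (F i))
  obtain ⟨x, hx⟩ := exists_extends_of_handles (hκ.trans_eq hcc.symm)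
    (exists_agree_of_regular hκ hcc) C hCcard (fun c => y (j c))
    (fun c => F (j c))
  refine ⟨x, ((mk_set_le _).trans_eq hI).antisymm (le_of_not_gt fun hlt => ?_)⟩
  set S := {i | ∀ a ∈ F i, a ∈ T → x a = y i a}
  have hord : (#S).ord < Ordinal.type (· < · : κ.ord.ToType → κ.ord.ToType → Prop) := by
    rw [Ordinal.type_toType]
    exact ord_lt_ord.2 hlt
  obtain ⟨o, ho⟩ : ∃ o, Ordinal.typein (α := κ.ord.ToType) (· < ·) o = (#S).ord :=
    ⟨Ordinal.enum (· < ·) ⟨_, hord⟩, Ordinal.typein_enum _ hord⟩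
  have hoS : #S ≤ #(Set.Iio o) := by
    have h := congrArg Ordinal.card ho
    rw [card_ord] at h
    rw [← h]
    exact le_of_eq rfl
  obtain ⟨c₀, hc₀, hoc⟩ := hC o
  -- `C` has the order type of an initial ordinal, so its proper initial segments are too small to
  -- contain all the `c` whose representative `x` extends. The fibre of such a late `c` lies in `S`
  -- and is larger than `S`.
  obtain ⟨c, hcx, hcc₀⟩ : ∃ c : C, (∀ a ∈ F (j c), x a = y (j c) a) ∧ (⟨c₀, hc₀⟩ : C) ≤ c := by
    by_contra! hb
    have hle := mk_le_mk_of_subset (s := {c : C | ∀ a ∈ F (j c), x a = y (j c) a})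
      (t := Set.Iic (⟨c₀, hc₀⟩ : C)) fun c hc => (hb c hc).le
    rw [hx] at hle
    have := mk_Iic_lt (⟨c₀, hc₀⟩ : C) (by rw [hCcard, hCtype]) (hCcard ▸ hκ.le)
    exact (hle.trans_lt this).ne hCcard.symm
  have h1 : #S ≤ #(Set.Iic c.1) := hoS.trans (mk_le_mk_of_subset fun a ha =>
    (le_of_lt ha).trans (hoc.trans hcc₀))
  refine (h1.trans_lt (hj c)).not_ge (mk_le_mk_of_subset fun i hi => ?_)
  exact agree_of_restrictCode_eq (Eq.symm hi) fun a ha _ => hcx a ha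

/-! ### Calibers and the formal implications -/

/-- Cardinals of uncountable cofinality are calibers of all powers of the two-point space. -/
theorem isCaliber_pi_bool (A : Type u) {κ : Cardinal.{u}} (hκ : ℵ₀ < κ.ord.cof) :
    IsCaliber (A → Bool) κ := by
  intro I hI U hU
  choose y hy using fun i => (hU i).2
  have hF (i : I) : ∃ F : Finset A, ∀ x : A → Bool, (∀ a ∈ F, x a = y i a) → x ∈ U i := by
    obtain ⟨F, u, hu, huU⟩ := isOpen_pi_iff.1 (hU i).1 _ (hy i)
    refine ⟨F, fun x hx => huU fun a ha => ?_⟩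
    rw [hx a ha]
    exact (hu a ha).2
  choose F hF using hF
  obtain ⟨x, hx⟩ := exists_extends_of_handles hκ (exists_agree_of_cof hκ) I hI y F
  exact ⟨_, hx, x, Set.mem_iInter₂.2 fun i hi => hF i x hi⟩

theorem IsCaliber.isPrecaliber {X : Type u} [TopologicalSpace X] {κ : Cardinal.{u}}
    (h : IsCaliber X κ) : IsPrecaliber X κ := by
  intro I hI U hU
  obtain ⟨J, hJ, x, hx⟩ := h I hI U hU
  refine ⟨J, hJ, fun F hF _ _ => ⟨x, fun A hA => ?_⟩⟩
  obtain ⟨i, hi, rfl⟩ := hF hA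
  exact Set.mem_iInter₂.1 hx i hi

theorem IsCentered.isLinked {X : Type u} {V : Set (Set X)} (h : IsCentered V) : IsLinked V := by
  intro A hA B hB
  have := h {A, B} (Set.pair_subset hA hB) (Set.toFinite _) (Set.insert_nonempty _ _)
  rwa [Set.sInter_pair] at this

theorem IsPrecaliber.isWeakPrecaliber {X : Type u} [TopologicalSpace X] {κ : Cardinal.{u}}
    (h : IsPrecaliber X κ) : IsWeakPrecaliber X κ := by
  intro I hI U hU
  obtain ⟨J, hJ, hc⟩ := h I hI U hU
  exact ⟨J, hJ, hc.isLinked⟩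

theorem IsCaliberStar.isPrecaliberStar {X : Type u} [TopologicalSpace X] {κ : Cardinal.{u}}
    (h : IsCaliberStar X κ) : IsPrecaliberStar X κ := by
  intro 𝒰 hκ h𝒰
  obtain ⟨𝒱, hs, hc, x, hx⟩ := h 𝒰 hκ h𝒰
  exact ⟨𝒱, hs, hc, fun F hF _ _ => ⟨x, fun A hA => hx A (hF hA)⟩⟩

theorem IsPrecaliberStar.isWeakPrecaliberStar {X : Type u} [TopologicalSpace X]
    {κ : Cardinal.{u}} (h : IsPrecaliberStar X κ) : IsWeakPrecaliberStar X κ := by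
  intro 𝒰 hκ h𝒰
  obtain ⟨𝒱, hs, hc, hcen⟩ := h 𝒰 hκ h𝒰
  exact ⟨𝒱, hs, hc, hcen.isLinked⟩

theorem IsCaliber.isCaliberStar {X : Type u} [TopologicalSpace X] {κ : Cardinal.{u}}
    (h : IsCaliber X κ) : IsCaliberStar X κ := by
  intro 𝒰 hκ h𝒰
  obtain ⟨J, hJ, x, hx⟩ := h 𝒰 hκ (fun A => A.1) fun A => h𝒰 A.1 A.2
  refine ⟨Subtype.val '' J, Subtype.coe_image_subset _ _,
    (mk_image_eq Subtype.val_injective).trans hJ, x, ?_⟩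
  rintro _ ⟨A, hA, rfl⟩
  exact Set.mem_iInter₂.1 hx A hA

/-! ### Failure at countable cofinality -/

/-- A set whose cardinality has countable cofinality splits into countably many smaller pieces. -/
theorem exists_nat_fibers_lt {I : Type u} {κ : Cardinal.{u}} (hκ : ℵ₀ ≤ κ)
    (hcof : κ.ord.cof ≤ ℵ₀) (hI : #I = κ) : ∃ g : I → ℕ, ∀ n, #(g ⁻¹' {n}) < κ := by
  obtain ⟨C, hC, hCcard⟩ := Order.exists_cof_eq κ.ord.ToType
  rw [Ordinal.cof_toType] at hCcard
  have : Countable C := mk_le_aleph0_iff.1 (hCcard.trans_le hcof)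
  obtain ⟨e⟩ : Nonempty (I ≃ κ.ord.ToType) := Cardinal.eq.1 (by simpa using hI)
  obtain ⟨f, hf⟩ := exists_injective_nat C
  choose c hc using fun i => hC (e i)
  refine ⟨fun i => f ⟨c i, (hc i).1⟩, fun n => ?_⟩
  by_cases hn : ∃ d, f d = n
  · obtain ⟨d, rfl⟩ := hn
    have hd : #(Set.Iic d.1) < κ := by
      simpa using mk_Iic_lt d.1 (by simp) (by simpa using hκ)
    refine lt_of_le_of_lt ?_ hd
    rw [← mk_image_eq e.injective]
    refine mk_le_mk_of_subset ?_
    rintro _ ⟨i, hi, rfl⟩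
    have := hf hi
    rw [← this]
    exact (hc i).2
  · have : (fun i => f ⟨c i, (hc i).1⟩) ⁻¹' {n} = ∅ := by
      ext i
      simpa using fun hi => hn ⟨_, hi⟩
    rw [this, mk_eq_zero]
    exact aleph0_pos.trans_le hκ

/-- The cylinder of points whose first non-vanishing coordinate along `e` is the `n`-th. -/
def firstTrue {A : Type u} (e : ℕ → A) (n : ℕ) : Set (A → Bool) :=
  {x | x (e n) = true ∧ ∀ k < n, x (e k) = false}

theorem isOpen_firstTrue {A : Type u} (e : ℕ → A) (n : ℕ) : IsOpen (firstTrue e n) := by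
  have h (a : A) (b : Bool) : IsOpen {x : A → Bool | x a = b} := by
    exact (isOpen_discrete ({b} : Set Bool)).preimage
      (continuous_apply (A := fun _ : A => Bool) a)
  have : firstTrue e n = {x | x (e n) = true} ∩ ⋂ k ∈ Set.Iio n, {x | x (e k) = false} := by
    ext x
    simp [firstTrue]
  rw [this]
  exact (h _ _).inter ((Set.finite_Iio n).isOpen_biInter fun k _ => h _ _)

theorem firstTrue_inter_nonempty {A : Type u} {e : ℕ → A} {m n : ℕ}
    (h : (firstTrue e m ∩ firstTrue e n).Nonempty) : m = n := by
  obtain ⟨x, ⟨hm, hm'⟩, hn, hn'⟩ := h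
  rcases lt_trichotomy m n with h | h | h
  · simp [hn' m h] at hm
  · exact h
  · simp [hm' n h] at hn

/-- The cylinders are pairwise disjoint, so a linked subfamily has all its indices in one fibre of
`g`. -/
theorem not_isWeakPrecaliber_pi_bool (A : Type u) [Infinite A] {κ : Cardinal.{u}} (hκ : ℵ₀ ≤ κ)
    (hcof : κ.ord.cof ≤ ℵ₀) : ¬ IsWeakPrecaliber (A → Bool) κ := by
  classical
  intro h
  obtain ⟨g, hg⟩ := exists_nat_fibers_lt hκ hcof (mk_out κ)
  obtain ⟨J, hJ, hlink⟩ := h κ.out (mk_out κ) (fun i => firstTrue (Infinite.natEmbedding A) (g i))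
    fun i => ⟨isOpen_firstTrue _ _, fun a => decide (a = Infinite.natEmbedding A (g i)),
      by simp, fun k hk => by simpa using hk.ne⟩
  obtain ⟨i, hi⟩ : J.Nonempty := by
    rw [Set.nonempty_iff_ne_empty]
    rintro rfl
    rw [mk_eq_zero] at hJ
    exact (aleph0_pos.trans_le hκ).ne hJ
  refine (hg (g i)).not_ge (hJ.symm.trans_le (mk_le_mk_of_subset fun j hj => ?_))
  exact firstTrue_inter_nonempty (hlink _ ⟨j, hj, rfl⟩ _ ⟨i, hi, rfl⟩)

theorem not_isWeakPrecaliberStar_pi_bool (A : Type u) [Infinite A] {κ : Cardinal.{u}}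
    (hκ : ℵ₀ ≤ κ) (hle : κ ≤ 2 ^ #A) (hcof : κ.ord.cof ≤ ℵ₀) :
    ¬ IsWeakPrecaliberStar (A → Bool) κ := by
  classical
  intro h
  obtain ⟨g, hg⟩ := exists_nat_fibers_lt hκ hcof (mk_out κ)
  obtain ⟨z⟩ : Nonempty (κ.out ↪ (A → Bool)) := by
    rw [← le_def, mk_out]
    simpa using hle
  -- The `ℕ` coordinates select the cylinder; the spare copy of `A` carries `κ` distinct points.
  obtain ⟨e⟩ : Nonempty (ℕ ⊕ A ≃ A) := by
    rw [← lift_mk_eq']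
    simp [add_eq_right]
  let ν : ℕ → A := fun n => e (.inl n)
  let p : κ.out → A → Bool := fun i a => Sum.elim (fun k => decide (k = g i)) (z i) (e.symm a)
  -- A second point of the same cylinder, differing from `p i` at `g i + 1`, keeps `U i` non-empty.
  let q : κ.out → A → Bool := fun i a => Sum.elim (fun k => decide (g i ≤ k)) (z i) (e.symm a)
  have hpV (i) : p i ∈ firstTrue ν (g i) := by
    simp only [firstTrue, ν, p, Set.mem_ofPred_eq, Equiv.symm_apply_apply, Sum.elim_inl]
    exact ⟨by simp, fun k hk => by simpa using hk.ne⟩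
  have hqV (i) : q i ∈ firstTrue ν (g i) := by
    simp only [firstTrue, ν, q, Set.mem_ofPred_eq, Equiv.symm_apply_apply, Sum.elim_inl]
    exact ⟨by simp, fun k hk => by simpa using hk⟩
  have hpq (i) : q i ≠ p i := fun hi => by
    have := congrFun hi (ν (g i + 1))
    simp [ν, p, q] at this
  have hp : p.Injective := fun i j hij => z.injective <| funext fun a => by
    simpa [p] using congrFun hij (e (.inr a))
  let U : κ.out → Set (A → Bool) := fun i => firstTrue ν (g i) \ {p i}
  have hUne (i) : (U i).Nonempty := ⟨q i, hqV i, hpq i⟩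
  have hgU {i j} (hij : (U i ∩ U j).Nonempty) : g i = g j :=
    firstTrue_inter_nonempty (hij.mono (Set.inter_subset_inter Set.sdiff_subset Set.sdiff_subset))
  have hU : U.Injective := by
    intro i j hij
    have hgij : g i = g j := hgU (by rw [hij, Set.inter_self]; exact hUne j)
    by_contra hne
    have : p i ∈ U j := ⟨hgij ▸ hpV i, fun hi => hne (hp hi)⟩
    rw [← hij] at this
    exact this.2 rfl
  obtain ⟨𝒱, hsub, hcard, hlink⟩ := h (Set.range U) ((mk_range_eq U hU).trans (mk_out κ)) (by
    rintro _ ⟨i, rfl⟩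
    exact ⟨(isOpen_firstTrue _ _).sdiff isClosed_singleton, hUne i⟩)
  obtain ⟨B, hB⟩ : 𝒱.Nonempty := by
    rw [Set.nonempty_iff_ne_empty]
    rintro rfl
    rw [mk_eq_zero] at hcard
    exact (aleph0_pos.trans_le hκ).ne hcard
  obtain ⟨i, rfl⟩ := hsub hB
  refine (hg (g i)).not_ge (hcard.symm.trans_le ?_)
  rw [← mk_image_eq (s := g ⁻¹' {g i}) hU]
  refine mk_le_mk_of_subset fun C hC => ?_
  obtain ⟨j, rfl⟩ := hsub hC
  exact ⟨j, hgU (hlink _ hC _ hB), rfl⟩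

/-! ### Counting open sets -/

/-- An infinite power of the two-point space has no more open sets than points. -/
theorem mk_isOpen_pi_bool_le (A : Type u) [Infinite A] :
    #{U : Set (A → Bool) | IsOpen U} ≤ 2 ^ #A := by
  -- An open set is determined by the finite partial functions whose cylinders it contains.
  have hinj : Function.Injective fun (U : {U : Set (A → Bool) | IsOpen U}) =>
      {s : Finset (A × Bool) | ∀ x : A → Bool, (∀ p ∈ s, x p.1 = p.2) → x ∈ U.1} := by
    classical
    have key (U V : {U : Set (A → Bool) | IsOpen U})
        (h : {s : Finset (A × Bool) | ∀ x : A → Bool, (∀ p ∈ s, x p.1 = p.2) → x ∈ U.1} =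
          {s : Finset (A × Bool) | ∀ x : A → Bool, (∀ p ∈ s, x p.1 = p.2) → x ∈ V.1}) :
        U.1 ⊆ V.1 := by
      intro y hy
      obtain ⟨F, u, hu, huU⟩ := isOpen_pi_iff.1 U.2 y hy
      have hs : F.image (fun a => (a, y a)) ∈
          {s : Finset (A × Bool) | ∀ x : A → Bool, (∀ p ∈ s, x p.1 = p.2) → x ∈ U.1} := by
        refine fun x hx => huU fun a ha => ?_
        rw [hx (a, y a) (Finset.mem_image_of_mem _ ha)]
        exact (hu a ha).2
      rw [h] at hs
      refine hs y fun p hp => ?_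
      obtain ⟨a, -, rfl⟩ := Finset.mem_image.1 hp
      rfl
    exact fun U V h => Subtype.ext ((key U V h).antisymm (key V U h.symm))
  refine (mk_le_of_injective hinj).trans_eq ?_
  rw [mk_set, mk_finset_of_infinite, mk_prod]
  congr 1
  simpa using mul_eq_left (aleph0_le_mk A) ((natCast_lt_aleph0 (n := 2)).le.trans (aleph0_le_mk A))
    two_ne_zero

theorem isCaliberStar_pi_bool_of_lt (A : Type u) {κ : Cardinal.{u}} (hκ : ℵ₀ ≤ κ)
    (hlt : 2 ^ #A < κ) : IsCaliberStar (A → Bool) κ := by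
  intro 𝒰 h𝒰 hopen
  exfalso
  rcases finite_or_infinite A with hA | hA
  · have : #𝒰 < ℵ₀ := mk_lt_aleph0
    exact (this.trans_le hκ).ne h𝒰
  · exact (((mk_le_mk_of_subset fun B hB => (hopen B hB).1).trans
      (mk_isOpen_pi_bool_le A)).trans_lt hlt).ne h𝒰

/-! ### The corollary -/

theorem mainTheorem4 (lam : Cardinal.{u}) :
    (ℵ₀ ≤ lam →
      calibers (CantorCube lam) = {κ | κ ∈ CN ∧ ℵ₀ < κ.ord.cof} ∧
      precalibers (CantorCube lam) = {κ | κ ∈ CN ∧ ℵ₀ < κ.ord.cof} ∧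
      weakPrecalibers (CantorCube lam) = {κ | κ ∈ CN ∧ ℵ₀ < κ.ord.cof}) ∧
    (calibersStar (CantorCube lam) =
        {κ | κ ∈ CN ∧ 2 ^ lam < κ} ∪ {κ | κ ∈ CN ∧ κ ≤ 2 ^ lam ∧ ℵ₀ < κ.ord.cof} ∧
      precalibersStar (CantorCube lam) =
        {κ | κ ∈ CN ∧ 2 ^ lam < κ} ∪ {κ | κ ∈ CN ∧ κ ≤ 2 ^ lam ∧ ℵ₀ < κ.ord.cof} ∧
      weakPrecalibersStar (CantorCube lam) =
        {κ | κ ∈ CN ∧ 2 ^ lam < κ} ∪ {κ | κ ∈ CN ∧ κ ≤ 2 ^ lam ∧ ℵ₀ < κ.ord.cof}) := by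
  constructor
  · intro hlam
    have : Infinite lam.out := by rwa [infinite_iff, mk_out]
    have hw {κ : Cardinal.{u}} (hκ : ℵ₀ ≤ κ) (h : IsWeakPrecaliber (CantorCube lam) κ) :
        ℵ₀ < κ.ord.cof :=
      lt_of_not_ge fun hcof => not_isWeakPrecaliber_pi_bool lam.out hκ hcof h
    refine ⟨?_, ?_, ?_⟩ <;> ext κ <;> refine and_congr_right fun hκ => ⟨fun h => hw hκ ?_, fun h => ?_⟩
    · exact h.isPrecaliber.isWeakPrecaliber
    · exact isCaliber_pi_bool _ h
    · exact h.isWeakPrecaliber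
    · exact (isCaliber_pi_bool _ h).isPrecaliber
    · exact h
    · exact (isCaliber_pi_bool _ h).isPrecaliber.isWeakPrecaliber
  · have hw {κ : Cardinal.{u}} (hκ : κ ∈ CN) (h : IsWeakPrecaliberStar (CantorCube lam) κ) :
        κ ∈ ({κ | κ ∈ CN ∧ 2 ^ lam < κ} ∪
          {κ | κ ∈ CN ∧ κ ≤ 2 ^ lam ∧ ℵ₀ < κ.ord.cof} : Set Cardinal.{u}) := by
      rcases lt_or_ge (2 ^ lam) κ with hlt | hle
      · exact Or.inl ⟨hκ, hlt⟩
      · refine Or.inr ⟨hκ, hle, lt_of_not_ge fun hcof => ?_⟩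
        -- A finite `lam` would make `2 ^ lam`, hence `κ`, finite.
        have : Infinite lam.out := by
          rw [infinite_iff, mk_out]
          by_contra! hfin
          exact (hle.trans_lt (power_lt_aleph0 (natCast_lt_aleph0 (n := 2)) hfin)).not_ge hκ
        exact not_isWeakPrecaliberStar_pi_bool lam.out hκ (by rwa [mk_out]) hcof h
    have hc {κ : Cardinal.{u}} (h : κ ∈ ({κ | κ ∈ CN ∧ 2 ^ lam < κ} ∪
          {κ | κ ∈ CN ∧ κ ≤ 2 ^ lam ∧ ℵ₀ < κ.ord.cof} : Set Cardinal.{u})) :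
        κ ∈ CN ∧ IsCaliberStar (CantorCube lam) κ := by
      rcases h with ⟨hκ, hlt⟩ | ⟨hκ, -, hcof⟩
      · exact ⟨hκ, isCaliberStar_pi_bool_of_lt lam.out hκ (by rwa [mk_out])⟩
      · exact ⟨hκ, (isCaliber_pi_bool _ hcof).isCaliberStar⟩
    refine ⟨?_, ?_, ?_⟩ <;> ext κ <;> refine ⟨fun h => hw h.1 ?_, fun h => ⟨(hc h).1, ?_⟩⟩
    · exact h.2.isPrecaliberStar.isWeakPrecaliberStar
    · exact (hc h).2
    · exact h.2.isWeakPrecaliberStar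
    · exact (hc h).2.isPrecaliberStar
    · exact h.2
    · exact (hc h).2.isPrecaliberStar.isWeakPrecaliberStar
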